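/- Let $d\in\mathbb N$ and let $V:\mathbb R^d\to\mathbb R$ satisfy $V\ge 0$ a.e., $V\in L^\infty_{\rm loc}(\mathbb R^d)$ and $\lim_{R\to\infty}\operatorname{ess\,inf}_{|x|\ge R}V(x)=\infty$. Let $H$ be the self-adjoint realization of $-\Delta+V$ on $L^2(\mathbb R^d)=L^2(\mathbb R^d;\mathbb C)$, that is, the closure of the (essentially self-adjoint) operator $-\Delta+V$ with domain $C_0^\infty(\mathbb R^d)$. Write $\langle x\rangle=(1+|x|^2)^{1/2}$ and $\langle f,g\rangle=\int_{\mathbb R^d} f\,\overline g\,dx$. Let $\lambda\in\mathbb R$ be an eigenvalue of $H$ whose eigenspace has finite dimension $m$. Then for every $\omega_0>0$ there is a constant $M=M_{\lambda,\omega_0}<\infty$ such that the following two statements hold. (1) Every eigenfunction $\chi_\lambda$ of $H$ for the eigenvalue $\lambda$ with $\|\chi_\lambda\|_{L^2(\mathbb R^d)}=1$ satisfies $$\|e^{\omega_0\langle\cdot\rangle}\chi_\lambda\|_{L^2(\mathbb R^d)}\le M .$$ (2) For every orthonormal basis $\chi_{\lambda,1},\dots,\chi_{\lambda,m}$ of the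 eigenspace, put $P_\lambda g=\sum_{j=1}^m\langle g,\chi_{\lambda,j}\rangle\,\chi_{\lambda,j}$ (on $L^2(\mathbb R^d)$ this is the spectral projection onto the eigenspace; the same formula is used for every measurable $g$ for which all the integrals $\langle g,\chi_{\lambda,j}\rangle$ converge absolutely). Then for every $f\in L^2(\mathbb R^d)$ the integrals $\langle e^{\omega_0\langle\cdot\rangle}f,\chi_{\lambda,j}\rangle$ converge absolutely, $e^{\omega_0\langle\cdot\rangle}P_\lambda e^{\omega_0\langle\cdot\rangle}f\in L^2(\mathbb R^d)$, and $$\|e^{\omega_0\langle\cdot\rangle}P_\lambda e^{\omega_0\langle\cdot\rangle}f\|_{L^2(\mathbb R^d)}\le m\,M^2\,\|f\|_{L^2(\mathbb R^d)} .$$ -/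

import Mathlib

open MeasureTheory Filter Topology
open scoped ENNReal

/-- `ℝᵈ` with its Euclidean norm. -/
abbrev Space (d : ℕ) : Type := EuclideanSpace ℝ (Fin d)

/-- The Hilbert space `L²(ℝᵈ; ℂ)`, with Lebesgue measure. -/
abbrev L2 (d : ℕ) : Type := Lp ℂ 2 (volume : Measure (Space d))

/-- Confining potentials: `V ≥ 0`, `V ∈ L^∞_loc(ℝᵈ)`, and the essential infimum of `V` over the
complement of the ball of radius `R` tends to `∞` as `R → ∞`. -/
structure IsConfiningPotential {d : ℕ} (V : Space d → ℝ) : Prop where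
  nonneg : ∀ᵐ x, 0 ≤ V x
  locallyBounded : ∀ K : Set (Space d), IsCompact K → MemLp V ∞ (volume.restrict K)
  confining : Tendsto
    (fun R : ℝ => essInf (fun x => (V x : EReal)) (volume.restrict (Metric.ball 0 R)ᶜ))
    atTop (𝓝 ⊤)

/-- The differential expression `-Δφ + Vφ`, for a smooth function `φ`. -/
noncomputable def schrodingerExpr {d : ℕ} (V : Space d → ℝ) (φ : Space d → ℂ) (x : Space d) : ℂ :=
  -(Laplacian.laplacian φ x) + (V x : ℂ) * φ x

/-- The graph of `-Δ + V` with domain `C₀^∞(ℝᵈ)`, in `L² × L²`: the pairs (class of `φ`,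
class of `-Δφ + Vφ`) with `φ` smooth and compactly supported. -/
noncomputable def schrodingerGraph {d : ℕ} (V : Space d → ℝ) : Submodule ℂ (L2 d × L2 d) where
  carrier := {p | ∃ φ : Space d → ℂ, ContDiff ℝ (⊤ : ℕ∞) φ ∧ HasCompactSupport φ ∧
    p.1 =ᵐ[volume] φ ∧ p.2 =ᵐ[volume] schrodingerExpr V φ}
  zero_mem' := by
    refine ⟨0, contDiff_const, HasCompactSupport.zero, Lp.coeFn_zero _ _ _, ?_⟩
    filter_upwards [Lp.coeFn_zero ℂ 2 (volume : Measure (Space d))] with x hx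
    have h0 : (0 : Space d → ℂ) = fun _ => 0 := rfl
    simp only [Prod.snd_zero, schrodingerExpr, h0, InnerProductSpace.laplacian_const, hx]
    simp
  add_mem' := by
    rintro ⟨u, w⟩ ⟨u', w'⟩ ⟨φ, hφ, hc, hu, hw⟩ ⟨ψ, hψ, hc', hu', hw'⟩
    refine ⟨φ + ψ, hφ.add hψ, hc.add hc', ?_, ?_⟩
    · exact (Lp.coeFn_add u u').trans (hu.add hu')
    · filter_upwards [Lp.coeFn_add w w', hw, hw'] with x h1 h2 h3
      have h4 := ((hφ.of_le (m := 2) (WithTop.coe_le_coe.2 le_top)).contDiffAt (x := x)).laplacian_add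
        ((hψ.of_le (m := 2) (WithTop.coe_le_coe.2 le_top)).contDiffAt (x := x))
      simp only [Prod.mk_add_mk, h1, Pi.add_apply, h2, h3, schrodingerExpr, h4]
      ring
  smul_mem' := by
    rintro c ⟨u, w⟩ ⟨φ, hφ, hc, hu, hw⟩
    refine ⟨c • φ, contDiff_const.smul hφ, hc.smul_left (f := fun _ => c), ?_, ?_⟩
    · exact (Lp.coeFn_smul c u).trans (hu.const_smul c)
    · filter_upwards [Lp.coeFn_smul c w, hw] with x h1 h2
      have h4 := InnerProductSpace.laplacian_smul c
        ((hφ.of_le (m := 2) (WithTop.coe_le_coe.2 le_top)).contDiffAt (x := x))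
      simp only [Prod.smul_mk, h1, Pi.smul_apply, h2, schrodingerExpr, h4, smul_eq_mul]
      ring

/-- The graph is single-valued, so that it is the graph of an operator. -/
theorem schrodingerGraph_snd_eq_zero {d : ℕ} (V : Space d → ℝ) (p : L2 d × L2 d)
    (hp : p ∈ schrodingerGraph V) (h : p.1 = 0) : p.2 = 0 := by
  obtain ⟨φ, hφ, hc, hu, hw⟩ := hp
  have h0 : φ =ᵐ[volume] fun _ => (0 : ℂ) := by
    rw [h] at hu
    exact hu.symm.trans (Lp.coeFn_zero _ _ _)
  have h1 : φ = fun _ => (0 : ℂ) := hφ.continuous.ae_eq_iff_eq volume continuous_const |>.1 h0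
  subst h1
  rw [Lp.eq_zero_iff_ae_eq_zero]
  filter_upwards [hw] with x hx
  simp only [hx, schrodingerExpr, InnerProductSpace.laplacian_const]
  simp

/-- The operator `-Δ + V` in `L²(ℝᵈ)` with domain `C₀^∞(ℝᵈ)`. -/
noncomputable def schrodingerMin {d : ℕ} (V : Space d → ℝ) : L2 d →ₗ.[ℂ] L2 d :=
  (schrodingerGraph V).toLinearPMap

theorem schrodingerMin_graph {d : ℕ} (V : Space d → ℝ) :
    (schrodingerMin V).graph = schrodingerGraph V :=
  Submodule.toLinearPMap_graph_eq _ (fun p hp h => schrodingerGraph_snd_eq_zero V p hp h)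

/-- The Schrödinger operator `H = -Δ + V`: the closure of `-Δ + V` on `C₀^∞(ℝᵈ)`. For confining
`V` the operator on `C₀^∞(ℝᵈ)` is essentially self-adjoint, so this is its unique self-adjoint
extension. -/
noncomputable def schrodinger {d : ℕ} (V : Space d → ℝ) : L2 d →ₗ.[ℂ] L2 d :=
  (schrodingerMin V).closure

/-- The eigenspace of an unbounded operator `T`: all `u` in the domain of `T` with `T u = μ u`. -/
def LinearPMap.eigenspace {F : Type*} [AddCommGroup F] [Module ℂ F] (T : F →ₗ.[ℂ] F) (μ : ℂ) :
    Submodule ℂ F :=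
  T.graph.comap (LinearMap.id.prod (μ • LinearMap.id))

theorem LinearPMap.mem_eigenspace {F : Type*} [AddCommGroup F] [Module ℂ F] (T : F →ₗ.[ℂ] F)
    (μ : ℂ) (u : F) : u ∈ T.eigenspace μ ↔ ∃ h : u ∈ T.domain, T ⟨u, h⟩ = μ • u := by
  change (u, μ • u) ∈ T.graph ↔ _
  rw [LinearPMap.mem_graph_iff]
  constructor
  · rintro ⟨y, rfl, h2⟩
    exact ⟨y.2, h2⟩
  · rintro ⟨h, h2⟩
    exact ⟨⟨u, h⟩, rfl, h2⟩

/-- The Japanese bracket `⟨x⟩ = (1 + |x|²)^{1/2}`. -/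
noncomputable def japaneseBracket {d : ℕ} (x : Space d) : ℝ := Real.sqrt (1 + ‖x‖ ^ 2)

/-- The exponential weight `e^{ω⟨x⟩}`, as a complex-valued function. -/
noncomputable def expWeight {d : ℕ} (ω : ℝ) (x : Space d) : ℂ :=
  (Real.exp (ω * japaneseBracket x) : ℂ)

/-- `P f = ∑ⱼ ⟨f, χⱼ⟩ χⱼ` with `⟨f, χ⟩ = ∫ f χ̄`. It is defined for functions `f`, not only for
`f ∈ L²`, since it has to be applied to `e^{ω⟨x⟩} f` with `f ∈ L²`. -/
noncomputable def spectralProjection {d m : ℕ} (χ : Fin m → L2 d) (f : Space d → ℂ)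
    (x : Space d) : ℂ :=
  ∑ j, (∫ y, f y * starRingEnd ℂ (χ j y)) * χ j x

/-- On `L²`, `spectralProjection` is the operator `f ↦ ∑ⱼ ⟨f, χⱼ⟩ χⱼ`
(Mathlib's inner product is conjugate-linear in its first argument). -/
theorem spectralProjection_ae_eq {d m : ℕ} (χ : Fin m → L2 d) (f : L2 d) :
    spectralProjection χ f =ᵐ[volume] (∑ j, (inner ℂ (χ j) f : ℂ) • χ j : L2 d) := by
  have h : ∀ᵐ x, ∀ j, ((inner ℂ (χ j) f : ℂ) • χ j : L2 d) x = (inner ℂ (χ j) f : ℂ) * χ j x := by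
    rw [ae_all_iff]
    intro j
    filter_upwards [Lp.coeFn_smul (inner ℂ (χ j) f : ℂ) (χ j)] with x hx
    simpa using hx
  filter_upwards [h, Lp.coeFn_finsetSum Finset.univ
    (fun j => (inner ℂ (χ j) f : ℂ) • χ j)] with x hx hs
  rw [hs]
  simp only [Finset.sum_apply]
  refine Finset.sum_congr rfl fun j _ => ?_
  rw [hx j]
  simp only [L2.inner_def, RCLike.inner_apply]

/-! This is Agmon's method. For a real `C¹` weight `g` and a test function `φ`, integration by parts
and a completed square give `Re ∫ g² φ̄ Δφ ≤ ∫ |∇g|² |φ|²` (`integral_sq_mul_inner_laplacian_le`).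
If `|∇g| ≤ ω g` and `W ≤ V`, then `∫ (W - ω²) g² |φ|² ≤ Re ∫ g² φ̄ (-Δφ + Vφ)`. For bounded `W` and
`g`, both sides are continuous in the `L²` pair `(φ, -Δφ + Vφ)`, so the estimate extends to the
closure of the graph (`integral_agmon_le_of_mem_closure`); neither elliptic regularity nor a form
domain is needed. On an eigenfunction `u` it reads `∫ (W - ω² - λ) g² |u|² ≤ 0`. Since `V` is large
off a ball, the weighted mass is controlled by the mass in the ball, uniformly in the cut-off of `g`
(`integral_boundedExpWeight_sq_le`). Fatou removes the cut-off. The weighted projection is then a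
sum of `m` rank-one operators built from the `e^{ω⟨x⟩} χⱼ`, each of norm at most `M²`. -/

/-! ### Weighted integration by parts for the Laplacian. -/

section IntegrationByParts

variable {E : Type*} [NormedAddCommGroup E] [InnerProductSpace ℝ E]

theorem fderiv_fderiv_apply {F : Type*} [NormedAddCommGroup F] [NormedSpace ℝ F] {φ : E → F}
    (hφ : ContDiff ℝ 2 φ) (v x : E) :
    fderiv ℝ (fun y => fderiv ℝ φ y v) x v = fderiv ℝ (fderiv ℝ φ) x v v := by
  have h : DifferentiableAt ℝ (fderiv ℝ φ) x :=
    ((hφ.fderiv_right (m := 1) (by norm_num)).differentiable (by norm_num)) x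
  rw [fderiv_clm_apply h (differentiableAt_const v)]
  simp

theorem fderiv_sq_smul_apply {g : E → ℝ} {φ : E → ℂ} {x : E} (hg : DifferentiableAt ℝ g x)
    (hφ : DifferentiableAt ℝ φ x) (v : E) :
    fderiv ℝ (fun y => (g y ^ 2) • φ y) x v =
      (g x ^ 2) • fderiv ℝ φ x v + (2 * g x * fderiv ℝ g x v) • φ x := by
  have h := ((hg.hasFDerivAt.pow 2).smul hφ.hasFDerivAt).fderiv
  change fderiv ℝ (fun y => (g y ^ 2) • φ y) x = _ at h
  rw [h]
  simp

/-- Expand `0 ≤ ‖a w + b z‖²`. It is used with `a = g`, `b = ∂ᵥg`, `z = φ`, `w = ∂ᵥφ`. -/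
theorem neg_inner_add_le (a b : ℝ) (z w : ℂ) :
    -inner ℝ ((a ^ 2) • w + (2 * a * b) • z) w ≤ b ^ 2 * ‖z‖ ^ 2 := by
  have h0 := sq_nonneg ‖a • w + b • z‖
  rw [norm_add_sq_real, norm_smul, norm_smul, mul_pow, mul_pow, Real.norm_eq_abs, sq_abs,
    Real.norm_eq_abs, sq_abs, real_inner_smul_left, real_inner_smul_right,
    real_inner_comm] at h0
  rw [inner_add_left, real_inner_smul_left, real_inner_smul_left, real_inner_self_eq_norm_sq]
  linarith

theorem sum_sq_apply_orthonormalBasis [FiniteDimensional ℝ E] {ι : Type*} [Fintype ι] (b : OrthonormalBasis ι ℝ E)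
    (L : E →L[ℝ] ℝ) : ∑ i, (L (b i)) ^ 2 = ‖L‖ ^ 2 := by
  have h := b.sum_sq_norm_inner_left ((InnerProductSpace.toDual ℝ E).symm L)
  rw [LinearIsometryEquiv.norm_map] at h
  rw [← h]
  simp

theorem Continuous.integrable_of_eq_zero {X F G : Type*} [TopologicalSpace X] [MeasurableSpace X]
    [OpensMeasurableSpace X] {μ : Measure X} [IsFiniteMeasureOnCompacts μ]
    [NormedAddCommGroup F] [Zero G] {f : X → F} {φ : X → G} (hf : Continuous f)
    (hc : HasCompactSupport φ) (h : ∀ x, φ x = 0 → f x = 0) : Integrable f μ :=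
  hf.integrable_of_hasCompactSupport (hc.mono fun _ hx h0 => hx (h _ h0))

variable [FiniteDimensional ℝ E] [MeasurableSpace E] [BorelSpace E] {μ : Measure E}
  [μ.IsAddHaarMeasure]

theorem integral_inner_fderiv_eq_neg {f ψ : E → ℂ} (hf : ContDiff ℝ 1 f) (hψ : ContDiff ℝ 1 ψ)
    (hc : HasCompactSupport f) (v : E) :
    ∫ x, inner ℝ (f x) (fderiv ℝ ψ x v) ∂μ = -∫ x, inner ℝ (fderiv ℝ f x v) (ψ x) ∂μ := by
  have hfv : Continuous fun x => fderiv ℝ f x v :=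
    (hf.continuous_fderiv (by norm_num)).clm_apply continuous_const
  have hψv : Continuous fun x => fderiv ℝ ψ x v :=
    (hψ.continuous_fderiv (by norm_num)).clm_apply continuous_const
  have hfvc : HasCompactSupport fun x => fderiv ℝ f x v := hc.fderiv_apply (𝕜 := ℝ) v
  refine integral_bilinear_fderiv_right_eq_neg_left_of_integrable (v := v) (B := innerSL ℝ)
    ?_ ?_ ?_ (fun x _ => hf.differentiable (by norm_num) x)
    (fun x _ => hψ.differentiable (by norm_num) x)
  · exact (hfv.inner hψ.continuous).integrable_of_eq_zero hfvc
      fun x hx => by rw [hx, map_zero, zero_apply]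
  · exact (hf.continuous.inner hψv).integrable_of_eq_zero hc
      fun x hx => by rw [hx, map_zero, zero_apply]
  · exact (hf.continuous.inner hψ.continuous).integrable_of_eq_zero hc
      fun x hx => by rw [hx, map_zero, zero_apply]

/-- Moving one derivative onto `g² φ` leaves exactly the integrand bounded by `neg_inner_add_le`.
Summing over an orthonormal basis gives the Laplacian. -/
theorem integral_sq_mul_inner_fderiv_fderiv_le {g : E → ℝ} {φ : E → ℂ} (hg : ContDiff ℝ 1 g)
    (hφ : ContDiff ℝ 2 φ) (hc : HasCompactSupport φ) (v : E) :
    ∫ x, g x ^ 2 * inner ℝ (φ x) (fderiv ℝ (fderiv ℝ φ) x v v) ∂μ ≤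
      ∫ x, (fderiv ℝ g x v) ^ 2 * ‖φ x‖ ^ 2 ∂μ := by
  have hφ1 : ContDiff ℝ 1 φ := hφ.of_le (by norm_num)
  have hψ1 : ContDiff ℝ 1 fun y => fderiv ℝ φ y v :=
    (hφ.fderiv_right (m := 1) (by norm_num)).clm_apply contDiff_const
  have hf1 : ContDiff ℝ 1 fun x => (g x ^ 2) • φ x := (hg.pow 2).smul hφ1
  have hfc : HasCompactSupport fun x => (g x ^ 2) • φ x :=
    hc.mono fun x hx h0 => hx (by
      change (g x ^ 2) • φ x = 0
      rw [h0, smul_zero])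
  have hgv : Continuous fun x => fderiv ℝ g x v :=
    (hg.continuous_fderiv (by norm_num)).clm_apply continuous_const
  have hgc := hg.continuous
  have hφc := hφ.continuous
  have hψc := hψ1.continuous
  have key := integral_inner_fderiv_eq_neg (μ := μ) hf1 hψ1 hfc v
  simp_rw [fderiv_fderiv_apply hφ, real_inner_smul_left, fderiv_sq_smul_apply
    (hg.differentiable (by norm_num) _) (hφ1.differentiable (by norm_num) _)] at key
  rw [key, ← integral_neg]
  refine integral_mono ?_ ?_ fun x => neg_inner_add_le _ _ _ _
  · exact Continuous.integrable_of_eq_zero (by fun_prop) (hc.fderiv_apply (𝕜 := ℝ) v)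
      fun x hx => by rw [hx, inner_zero_right, neg_zero]
  · exact Continuous.integrable_of_eq_zero (by fun_prop) hc fun x hx => by simp [hx]

theorem integral_sq_mul_inner_laplacian_le {g : E → ℝ} {φ : E → ℂ} (hg : ContDiff ℝ 1 g)
    (hφ : ContDiff ℝ 2 φ) (hc : HasCompactSupport φ) :
    ∫ x, g x ^ 2 * inner ℝ (φ x) (Laplacian.laplacian φ x) ∂μ ≤
      ∫ x, ‖fderiv ℝ g x‖ ^ 2 * ‖φ x‖ ^ 2 ∂μ := by
  let b := stdOrthonormalBasis ℝ E
  have hφ1 : ContDiff ℝ 1 φ := hφ.of_le (by norm_num)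
  have hgc := hg.continuous_fderiv (by norm_num)
  have hφc : Continuous (fderiv ℝ (fderiv ℝ φ)) :=
    (hφ.fderiv_right (m := 1) (by norm_num)).continuous_fderiv (by norm_num)
  have hφ0 := hφ.continuous
  have hg0 := hg.continuous
  simp_rw [← sum_sq_apply_orthonormalBasis b, Finset.sum_mul,
    InnerProductSpace.laplacian_eq_iteratedFDeriv_orthonormalBasis φ b, iteratedFDeriv_two_apply,
    inner_sum, Finset.mul_sum]
  rw [integral_finsetSum, integral_finsetSum]
  · exact Finset.sum_le_sum fun i _ => integral_sq_mul_inner_fderiv_fderiv_le hg hφ hc (b i)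
  · intro i _
    exact Continuous.integrable_of_eq_zero (by fun_prop) hc fun x hx => by simp [hx]
  · intro i _
    exact Continuous.integrable_of_eq_zero (by simp; fun_prop) hc fun x hx => by simp [hx]

end IntegrationByParts

/-! ### Quadratic forms with bounded coefficients on `L²`. -/

section BoundedForms

variable {α : Type*} [MeasurableSpace α] {μ : Measure α}

/-- Multiplication by `b ∈ L^∞` is a bounded operator on `L²`, obtained here from the Hölder pairing
`L^∞ × L² → L²`. -/
theorem continuous_integral_mul_inner {b : α → ℝ} (hb : AEStronglyMeasurable b μ) {C : ℝ}
    (hC : ∀ x, |b x| ≤ C) :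
    Continuous fun p : Lp ℂ 2 μ × Lp ℂ 2 μ => ∫ x, b x * inner ℝ (p.1 x) (p.2 x) ∂μ := by
  have hB : MemLp b ∞ μ := memLp_top_of_bound hb C (.of_forall hC)
  let T := (ContinuousLinearMap.lsmul ℝ ℝ : ℝ →L[ℝ] ℂ →L[ℝ] ℂ).holderL μ ∞ 2 2 (hB.toLp b)
  have h : (fun p : Lp ℂ 2 μ × Lp ℂ 2 μ => ∫ x, b x * inner ℝ (p.1 x) (p.2 x) ∂μ) =
      fun p => inner ℝ p.1 (T p.2) := by
    funext p
    rw [L2.inner_def]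
    refine integral_congr_ae ?_
    filter_upwards [hB.coeFn_toLp, (ContinuousLinearMap.lsmul ℝ ℝ :
      ℝ →L[ℝ] ℂ →L[ℝ] ℂ).coeFn_holder (r := 2) (hB.toLp b) p.2] with x h1 h2
    change _ = inner ℝ (p.1 x) ((ContinuousLinearMap.holder _ _ _ _ : Lp ℂ 2 μ) x)
    rw [h2, h1, ContinuousLinearMap.lsmul_apply, real_inner_smul_right]
  rw [h]
  fun_prop

theorem integrable_mul_inner {b : α → ℝ} (hb : AEStronglyMeasurable b μ) {C : ℝ}
    (hC : ∀ x, |b x| ≤ C) (u w : Lp ℂ 2 μ) :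
    Integrable (fun x => b x * inner ℝ (u x) (w x)) μ :=
  (L2.integrable_inner (𝕜 := ℝ) u w).bdd_mul hb (.of_forall hC)

end BoundedForms

/-! ### Eigenvectors as graph limits, and growth of the potential. -/

theorem mem_closure_schrodingerGraph {d : ℕ} {V : Space d → ℝ} {μ : ℂ} {u : L2 d}
    (hu : u ∈ (schrodinger V).eigenspace μ) :
    (u, μ • u) ∈ closure (schrodingerGraph V : Set (L2 d × L2 d)) := by
  replace hu : (u, μ • u) ∈ (schrodingerMin V).closure.graph := hu
  rw [← schrodingerMin_graph]
  -- Closability need not be proved: for a non-closable operator `closure` returns the operator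
  -- itself, whose graph lies in the closure anyway.
  by_cases h : (schrodingerMin V).IsClosable
  · rwa [← h.graph_closure_eq_closure_graph] at hu
  · rw [LinearPMap.closure_def' h] at hu
    exact subset_closure hu

theorem IsConfiningPotential.exists_radius {d : ℕ} {V : Space d → ℝ} (hV : IsConfiningPotential V)
    (K : ℝ) : ∃ R : ℝ, ∀ᵐ x, R ≤ ‖x‖ → K ≤ V x := by
  have h := hV.confining.eventually (lt_mem_nhds (EReal.coe_lt_top K))
  obtain ⟨R, hR⟩ := h.exists
  refine ⟨R, ?_⟩
  have h1 := ae_lt_of_lt_essInf hR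
  rw [ae_restrict_iff' Metric.isOpen_ball.measurableSet.compl] at h1
  filter_upwards [h1] with x hx hRx
  exact (EReal.coe_lt_coe_iff.1 (hx (by simpa using hRx))).le

/-! ### The exponential weight and its bounded regularization. -/

section Weight

variable {d : ℕ}

theorem one_le_japaneseBracket (x : Space d) : 1 ≤ japaneseBracket x := by
  rw [japaneseBracket, Real.one_le_sqrt]
  nlinarith [sq_nonneg ‖x‖]

theorem norm_le_japaneseBracket (x : Space d) : ‖x‖ ≤ japaneseBracket x :=
  Real.le_sqrt_of_sq_le (by linarith)

theorem japaneseBracket_le_of_norm_le {x : Space d} {R : ℝ} (h : ‖x‖ ≤ R) :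
    japaneseBracket x ≤ Real.sqrt (1 + R ^ 2) :=
  Real.sqrt_le_sqrt (by gcongr)

theorem contDiff_japaneseBracket : ContDiff ℝ 1 (japaneseBracket : Space d → ℝ) :=
  (contDiff_const.add (contDiff_norm_sq ℝ)).sqrt fun x => by positivity

theorem continuous_expWeight (ω : ℝ) : Continuous (expWeight ω : Space d → ℂ) := by
  have := (contDiff_japaneseBracket (d := d)).continuous
  unfold expWeight
  fun_prop

theorem norm_fderiv_japaneseBracket_le (x : Space d) : ‖fderiv ℝ japaneseBracket x‖ ≤ 1 := by
  have hJ : 0 < japaneseBracket x := zero_lt_one.trans_le (one_le_japaneseBracket x)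
  have h : HasFDerivAt japaneseBracket ((1 / (2 * japaneseBracket x)) • (2 • innerSL ℝ x)) x :=
    (((hasStrictFDerivAt_norm_sq x).hasFDerivAt).const_add 1).sqrt (by positivity)
  rw [h.fderiv]
  have h2 : (1 / (2 * japaneseBracket x)) • (2 • innerSL ℝ x) =
      (1 / japaneseBracket x) • innerSL ℝ x := by
    rw [← Nat.cast_smul_eq_nsmul ℝ, smul_smul]
    congr 1
    field_simp
    norm_num
  rw [h2, norm_smul, innerSL_apply_norm, Real.norm_of_nonneg (by positivity), one_div_mul_eq_div,
    div_le_one hJ]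
  exact norm_le_japaneseBracket x

/-- The bounded weight `e^{ω⟨x⟩ / (1 + ε⟨x⟩)}`, which increases to `e^{ω⟨x⟩}` as `ε → 0`. -/
noncomputable def boundedExpWeight (ω ε : ℝ) (x : Space d) : ℝ :=
  Real.exp (ω * japaneseBracket x / (1 + ε * japaneseBracket x))

theorem boundedExpWeight_pos (ω ε : ℝ) (x : Space d) : 0 < boundedExpWeight ω ε x :=
  Real.exp_pos _

theorem boundedExpWeight_le_exp {ω ε : ℝ} (hω : 0 ≤ ω) (hε : 0 ≤ ε) (x : Space d) :
    boundedExpWeight ω ε x ≤ Real.exp (ω * japaneseBracket x) := by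
  have hJ : 0 < japaneseBracket x := zero_lt_one.trans_le (one_le_japaneseBracket x)
  refine Real.exp_le_exp.2 (div_le_self (by positivity) ?_)
  have : 0 ≤ ε * japaneseBracket x := by positivity
  linarith

theorem boundedExpWeight_le {ω ε : ℝ} (hω : 0 ≤ ω) (hε : 0 < ε) (x : Space d) :
    boundedExpWeight ω ε x ≤ Real.exp (ω / ε) := by
  have hJ : 0 < japaneseBracket x := zero_lt_one.trans_le (one_le_japaneseBracket x)
  refine Real.exp_le_exp.2 ?_
  rw [div_le_div_iff₀ (by positivity) hε]
  nlinarith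

theorem contDiff_boundedExpWeight {ω ε : ℝ} (hε : 0 ≤ ε) :
    ContDiff ℝ 1 (boundedExpWeight ω ε : Space d → ℝ) := by
  have hJ := contDiff_japaneseBracket (d := d)
  refine ((contDiff_const.mul hJ).div (contDiff_const.add (contDiff_const.mul hJ))
    fun x => ?_).exp
  have := zero_lt_one.trans_le (one_le_japaneseBracket x)
  positivity

/-- The exponent `ωt / (1 + εt)` has derivative `ω / (1 + εt)² ≤ ω` for `t ≥ 0`, and the gradient of
`⟨x⟩` has norm at most 1. The bound is thus uniform in `ε`. -/
theorem norm_fderiv_boundedExpWeight_le {ω ε : ℝ} (hω : 0 ≤ ω) (hε : 0 ≤ ε) (x : Space d) :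
    ‖fderiv ℝ (boundedExpWeight ω ε) x‖ ≤ ω * boundedExpWeight ω ε x := by
  have hJ : 0 < japaneseBracket x := zero_lt_one.trans_le (one_le_japaneseBracket x)
  have hd : 0 < 1 + ε * japaneseBracket x := by positivity
  have h1 : HasDerivAt (fun t : ℝ => Real.exp (ω * t / (1 + ε * t)))
      (boundedExpWeight ω ε x * (ω / (1 + ε * japaneseBracket x) ^ 2)) (japaneseBracket x) := by
    have h := ((((hasDerivAt_id (japaneseBracket x)).const_mul ω).div
      (((hasDerivAt_id (japaneseBracket x)).const_mul ε).const_add 1) hd.ne')).exp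
    refine h.congr_deriv ?_
    simp only [id, boundedExpWeight, Pi.div_apply]
    congr 2
    ring
  have h2 := (contDiff_japaneseBracket.differentiable (by norm_num) x).hasFDerivAt
  have h3 : HasFDerivAt (boundedExpWeight ω ε) _ x := h1.comp_hasFDerivAt x h2
  have hg := boundedExpWeight_pos ω ε x
  rw [h3.fderiv, norm_smul, Real.norm_of_nonneg (by positivity)]
  have h4 : ω / (1 + ε * japaneseBracket x) ^ 2 ≤ ω :=
    div_le_self hω (one_le_pow₀ (by nlinarith))
  calc _ ≤ boundedExpWeight ω ε x * ω * 1 := by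
        gcongr
        exact norm_fderiv_japaneseBracket_le x
    _ = _ := by ring

theorem tendsto_boundedExpWeight (ω : ℝ) (x : Space d) :
    Tendsto (fun n : ℕ => boundedExpWeight ω (1 / ((n : ℝ) + 1)) x) atTop
      (𝓝 (Real.exp (ω * japaneseBracket x))) := by
  have h : Tendsto (fun n : ℕ => ω * japaneseBracket x /
      (1 + 1 / ((n : ℝ) + 1) * japaneseBracket x)) atTop
      (𝓝 (ω * japaneseBracket x / (1 + 0 * japaneseBracket x))) :=
    tendsto_const_nhds.div (tendsto_const_nhds.add
      ((tendsto_one_div_add_atTop_nhds_zero_nat (𝕜 := ℝ)).mul_const _)) (by simp)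
  simpa [boundedExpWeight] using h.rexp

end Weight

/-! ### The Agmon estimate. -/

section AgmonEstimate

variable {d : ℕ}

/-- The bounded minorant `W` replaces `V` because the form with coefficient `V g²` need not be
continuous on `L²`. -/
theorem integral_agmon_le_of_mem_graph {V W g : Space d → ℝ} {ω C D : ℝ}
    (hWm : Measurable W) (hWD : ∀ x, |W x| ≤ D) (hWV : ∀ᵐ x, W x ≤ V x)
    (hg : ContDiff ℝ 1 g) (hgC : ∀ x, |g x| ≤ C)
    (hω : ∀ x, ‖fderiv ℝ g x‖ ^ 2 ≤ ω ^ 2 * g x ^ 2)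
    {p : L2 d × L2 d} (hp : p ∈ schrodingerGraph V) :
    ∫ x, (W x - ω ^ 2) * g x ^ 2 * inner ℝ (p.1 x) (p.1 x) ≤
      ∫ x, g x ^ 2 * inner ℝ (p.1 x) (p.2 x) := by
  obtain ⟨φ, hφ, hc, hu, hw⟩ := hp
  have hφ2 : ContDiff ℝ 2 φ := hφ.of_le (WithTop.coe_le_coe.2 le_top)
  have hφc := hφ.continuous
  have hgc := hg.continuous
  have hΔ : Continuous (Laplacian.laplacian φ) := by
    have := (hφ2.fderiv_right (m := 1) (by norm_num)).continuous_fderiv (by norm_num)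
    rw [InnerProductSpace.laplacian_eq_iteratedFDeriv_stdOrthonormalBasis]
    simp_rw [iteratedFDeriv_two_apply]
    fun_prop
  have hg2 : ∀ x, |g x ^ 2| ≤ C ^ 2 := fun x => by
    rw [abs_pow]
    exact pow_le_pow_left₀ (abs_nonneg _) (hgC x) 2
  have hD : ∀ x, |(W x - ω ^ 2) * g x ^ 2| ≤ (D + ω ^ 2) * C ^ 2 := fun x => by
    rw [abs_mul]
    have h1 : |W x - ω ^ 2| ≤ D + ω ^ 2 := (abs_sub _ _).trans (by
      rw [abs_of_nonneg (sq_nonneg ω)]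
      gcongr
      exact hWD x)
    exact mul_le_mul h1 (hg2 x) (abs_nonneg _) ((abs_nonneg _).trans h1)
  have i0 : Integrable fun x => (W x - ω ^ 2) * g x ^ 2 * inner ℝ (p.1 x) (p.1 x) :=
    integrable_mul_inner (by fun_prop) hD p.1 p.1
  have i1 : Integrable fun x => g x ^ 2 * inner ℝ (p.1 x) (p.2 x) :=
    integrable_mul_inner (by fun_prop) hg2 p.1 p.2
  have i2 : Integrable fun x => g x ^ 2 * inner ℝ (φ x) (Laplacian.laplacian φ x) :=
    Continuous.integrable_of_eq_zero (by fun_prop) hc fun x hx => by simp [hx]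
  have i3 : Integrable fun x => ‖fderiv ℝ g x‖ ^ 2 * ‖φ x‖ ^ 2 := by
    have := hg.continuous_fderiv (by norm_num)
    exact Continuous.integrable_of_eq_zero (by fun_prop) hc fun x hx => by simp [hx]
  have hlap := integral_sq_mul_inner_laplacian_le (μ := volume) hg hφ2 hc
  have hmono := integral_mono_ae i0 ((i1.add i2).sub i3) (by
    filter_upwards [hu, hw, hWV] with x h1 h2 h3
    simp only [Pi.sub_apply, Pi.add_apply, h1, h2, schrodingerExpr]
    have h4 : ((V x : ℂ)) * φ x = (V x) • φ x := (Complex.real_smul).symm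
    rw [h4, inner_add_right, inner_neg_right, real_inner_smul_right, real_inner_self_eq_norm_sq]
    have h5 : 0 ≤ (V x - W x) * (g x ^ 2 * ‖φ x‖ ^ 2) :=
      mul_nonneg (sub_nonneg.2 h3) (by positivity)
    have h6 := mul_le_mul_of_nonneg_right (hω x) (sq_nonneg ‖φ x‖)
    linarith)
  rw [integral_sub' (i1.add i2) i3, integral_add' i1 i2] at hmono
  linarith

theorem integral_agmon_le_of_mem_closure {V W g : Space d → ℝ} {ω C D : ℝ}
    (hWm : Measurable W) (hWD : ∀ x, |W x| ≤ D) (hWV : ∀ᵐ x, W x ≤ V x)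
    (hg : ContDiff ℝ 1 g) (hgC : ∀ x, |g x| ≤ C)
    (hω : ∀ x, ‖fderiv ℝ g x‖ ^ 2 ≤ ω ^ 2 * g x ^ 2)
    {p : L2 d × L2 d} (hp : p ∈ closure (schrodingerGraph V : Set (L2 d × L2 d))) :
    ∫ x, (W x - ω ^ 2) * g x ^ 2 * inner ℝ (p.1 x) (p.1 x) ≤
      ∫ x, g x ^ 2 * inner ℝ (p.1 x) (p.2 x) := by
  have hgc := hg.continuous
  have hg2 : ∀ x, |g x ^ 2| ≤ C ^ 2 := fun x => by
    rw [abs_pow]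
    exact pow_le_pow_left₀ (abs_nonneg _) (hgC x) 2
  have hD : ∀ x, |(W x - ω ^ 2) * g x ^ 2| ≤ (D + ω ^ 2) * C ^ 2 := fun x => by
    rw [abs_mul]
    have h1 : |W x - ω ^ 2| ≤ D + ω ^ 2 := (abs_sub _ _).trans (by
      rw [abs_of_nonneg (sq_nonneg ω)]
      gcongr
      exact hWD x)
    exact mul_le_mul h1 (hg2 x) (abs_nonneg _) ((abs_nonneg _).trans h1)
  have c1 : Continuous fun p : L2 d × L2 d =>
      ∫ x, (W x - ω ^ 2) * g x ^ 2 * inner ℝ (p.1 x) (p.1 x) :=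
    (continuous_integral_mul_inner (μ := volume) (by fun_prop) hD).comp
      (continuous_fst.prodMk continuous_fst)
  have c2 : Continuous fun p : L2 d × L2 d => ∫ x, g x ^ 2 * inner ℝ (p.1 x) (p.2 x) :=
    continuous_integral_mul_inner (by fun_prop) hg2
  exact closure_minimal (fun q hq => integral_agmon_le_of_mem_graph hWm hWD hWV hg hgC hω hq)
    (isClosed_le c1 c2) hp

theorem eLpNorm_two_eq_ofReal_sqrt {α : Type*} [MeasurableSpace α] {μ : Measure α} {f : α → ℂ}
    (hf : MemLp f 2 μ) : eLpNorm f 2 μ = ENNReal.ofReal (Real.sqrt (∫ x, ‖f x‖ ^ 2 ∂μ)) := by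
  rw [hf.eLpNorm_eq_integral_rpow_norm (by norm_num) (by norm_num), Real.sqrt_eq_rpow]
  simp

/-- The Agmon bound for bounded weights, uniform in the cut-off parameter. -/
theorem integral_boundedExpWeight_sq_le {V : Space d → ℝ} (hV0 : ∀ᵐ x, 0 ≤ V x) {lam ω ε R : ℝ}
    (hω : 0 ≤ ω) (hε : 0 < ε)
    (hR : ∀ᵐ x : Space d, R ≤ ‖x‖ → ω ^ 2 + |lam| + 1 ≤ V x) {u : L2 d}
    (hu : u ∈ (schrodinger V).eigenspace (lam : ℂ)) :
    ∫ x, boundedExpWeight ω ε x ^ 2 * ‖u x‖ ^ 2 ≤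
      (ω ^ 2 + |lam| + 1) * Real.exp (ω * Real.sqrt (1 + R ^ 2)) ^ 2 * ‖u‖ ^ 2 := by
  -- The summand 1 leaves a coefficient `K - ω² - λ ≥ 1` where `W = K`.
  set K := ω ^ 2 + |lam| + 1 with hK
  have hK0 : 0 ≤ K := by positivity
  set A := Real.exp (ω * Real.sqrt (1 + R ^ 2)) ^ 2
  let W : Space d → ℝ := {x : Space d | R ≤ ‖x‖}.indicator fun _ => K
  have hS : MeasurableSet {x : Space d | R ≤ ‖x‖} := measurableSet_le measurable_const measurable_norm
  have hWm : Measurable W := measurable_const.indicator hS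
  have hW0 : ∀ x, 0 ≤ W x := Set.indicator_nonneg fun _ _ => hK0
  have hWD : ∀ x, |W x| ≤ K := fun x => by
    rw [abs_of_nonneg (hW0 x)]
    exact Set.indicator_le_self' (fun _ _ => hK0) x
  have hWV : ∀ᵐ x, W x ≤ V x := by
    filter_upwards [hV0, hR] with x h0 h1
    exact Set.indicator_apply_le' (fun h => h1 h) fun _ => h0
  have hg : ContDiff ℝ 1 (boundedExpWeight ω ε : Space d → ℝ) := contDiff_boundedExpWeight hε.le
  have hgc := hg.continuous
  have hgC : ∀ x : Space d, |boundedExpWeight ω ε x| ≤ Real.exp (ω / ε) := fun x => by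
    rw [abs_of_pos (boundedExpWeight_pos _ _ _)]
    exact boundedExpWeight_le hω hε x
  have hd : ∀ x : Space d,
      ‖fderiv ℝ (boundedExpWeight ω ε) x‖ ^ 2 ≤ ω ^ 2 * boundedExpWeight ω ε x ^ 2 := fun x => by
    rw [← mul_pow]
    exact pow_le_pow_left₀ (norm_nonneg _) (norm_fderiv_boundedExpWeight_le hω hε.le x) 2
  have hg2 : ∀ x : Space d, |boundedExpWeight ω ε x ^ 2| ≤ Real.exp (ω / ε) ^ 2 := fun x => by
    rw [abs_pow]
    exact pow_le_pow_left₀ (abs_nonneg _) (hgC x) 2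
  have main := integral_agmon_le_of_mem_closure hWm hWD hWV hg hgC hd
    (mem_closure_schrodingerGraph hu)
  have hI : ∀ b : Space d → ℝ, Measurable b → (∃ C, ∀ x, |b x| ≤ C) →
      Integrable fun x => b x * ‖u x‖ ^ 2 := fun b hb ⟨C, hC⟩ => by
    simpa only [real_inner_self_eq_norm_sq] using
      integrable_mul_inner hb.aestronglyMeasurable hC u u
  have i1 := hI (fun x => boundedExpWeight ω ε x ^ 2) (by fun_prop) ⟨_, hg2⟩
  have i2 := hI (fun x => W x * boundedExpWeight ω ε x ^ 2) (by fun_prop)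
    ⟨K * Real.exp (ω / ε) ^ 2, fun x => by
      rw [abs_mul]
      exact mul_le_mul (hWD x) (hg2 x) (abs_nonneg _) hK0⟩
  have i3 := hI (fun _ => 1) measurable_const ⟨1, by simp⟩
  have e1 : ∫ x, (W x - ω ^ 2) * boundedExpWeight ω ε x ^ 2 * inner ℝ (u x) (u x) =
      (∫ x, W x * boundedExpWeight ω ε x ^ 2 * ‖u x‖ ^ 2) -
        ω ^ 2 * ∫ x, boundedExpWeight ω ε x ^ 2 * ‖u x‖ ^ 2 := by
    rw [← integral_const_mul, ← integral_sub i2 (i1.const_mul _)]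
    congr 1 with x
    rw [real_inner_self_eq_norm_sq]
    ring
  have e2 : ∫ x, boundedExpWeight ω ε x ^ 2 * inner ℝ (u x) (((lam : ℂ) • u : L2 d) x) =
      lam * ∫ x, boundedExpWeight ω ε x ^ 2 * ‖u x‖ ^ 2 := by
    rw [← integral_const_mul]
    refine integral_congr_ae ?_
    filter_upwards [Lp.coeFn_smul (lam : ℂ) u] with x hx
    have h4 : ((lam : ℂ)) * u x = lam • u x := (Complex.real_smul).symm
    rw [hx, Pi.smul_apply, smul_eq_mul, h4, real_inner_smul_right, real_inner_self_eq_norm_sq]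
    ring
  have e3 : ∫ x, 1 * ‖u x‖ ^ 2 = ‖u‖ ^ 2 := by
    rw [← real_inner_self_eq_norm_sq, L2.inner_def]
    simp only [real_inner_self_eq_norm_sq, one_mul]
  -- Pointwise `K g² ≤ W g² + K A`: for `‖x‖ ≥ R` because `W = K`, and inside the ball because `g² ≤
  -- A` there. Combined with `∫ W g² |u|² ≤ (ω² + λ) ∫ g² |u|²`, this isolates `∫ g² |u|²` with
  -- coefficient at least 1.
  have hmono := integral_mono (i1.const_mul K) (i2.add (i3.const_mul (K * A))) fun x => by
    have hux := sq_nonneg ‖u x‖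
    simp only [Pi.add_apply]
    by_cases hx : R ≤ ‖x‖
    · have hWx : W x = K := Set.indicator_of_mem (s := {x : Space d | R ≤ ‖x‖}) hx _
      have : 0 ≤ K * A * (1 * ‖u x‖ ^ 2) := by positivity
      rw [hWx]
      linarith
    · have hWx : W x = 0 := Set.indicator_of_notMem (s := {x : Space d | R ≤ ‖x‖}) hx _
      have h1 : boundedExpWeight ω ε x ≤ Real.exp (ω * Real.sqrt (1 + R ^ 2)) :=
        (boundedExpWeight_le_exp hω hε.le x).trans (Real.exp_le_exp.2
          (mul_le_mul_of_nonneg_left (japaneseBracket_le_of_norm_le (not_le.1 hx).le) hω))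
      have h2 : boundedExpWeight ω ε x ^ 2 ≤ A :=
        pow_le_pow_left₀ (boundedExpWeight_pos _ _ _).le h1 2
      have h3 := mul_le_mul_of_nonneg_left (mul_le_mul_of_nonneg_right h2 hux) hK0
      rw [hWx]
      linarith
  rw [integral_add' i2 (i3.const_mul _), integral_const_mul, integral_const_mul, e3] at hmono
  have hI0 : 0 ≤ ∫ x, boundedExpWeight ω ε x ^ 2 * ‖u x‖ ^ 2 :=
    integral_nonneg fun x => by positivity
  simp only at main
  rw [e1, e2] at main
  have h5 := mul_le_mul_of_nonneg_right (le_abs_self lam) hI0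
  rw [hK] at hmono ⊢
  linarith

/-- Fatou's lemma along `ε = 1 / (n + 1)`, since the bound for the bounded weights does not depend
on `ε`. -/
theorem eLpNorm_expWeight_mul_le {V : Space d → ℝ} (hV0 : ∀ᵐ x, 0 ≤ V x) {lam ω R : ℝ}
    (hω : 0 ≤ ω) (hR : ∀ᵐ x : Space d, R ≤ ‖x‖ → ω ^ 2 + |lam| + 1 ≤ V x) {u : L2 d}
    (hu : u ∈ (schrodinger V).eigenspace (lam : ℂ)) :
    eLpNorm (fun x => expWeight ω x * u x) 2 volume ≤
      ENNReal.ofReal (Real.sqrt (ω ^ 2 + |lam| + 1) * Real.exp (ω * Real.sqrt (1 + R ^ 2)) *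
        ‖u‖) := by
  have hm : ∀ n : ℕ, MemLp (fun x => boundedExpWeight ω (1 / ((n : ℝ) + 1)) x • u x) 2 volume :=
    fun n => (Lp.memLp u).smul (memLp_top_of_bound (C := Real.exp (ω / (1 / ((n : ℝ) + 1))))
      (contDiff_boundedExpWeight (by positivity)).continuous.aestronglyMeasurable
      (.of_forall fun x => by
        rw [Real.norm_of_nonneg (boundedExpWeight_pos _ _ _).le]
        exact boundedExpWeight_le hω (by positivity) x))
  refine (Lp.eLpNorm_lim_le_liminf_eLpNorm (fun n => (hm n).1) _ (.of_forall fun x => ?_)).trans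
    (liminf_le_of_le (by isBoundedDefault) fun b hb => ?_)
  · have h := (tendsto_boundedExpWeight ω x).smul_const (u x)
    rwa [Complex.real_smul] at h
  · obtain ⟨n, hn⟩ := hb.exists
    refine hn.trans ?_
    rw [eLpNorm_two_eq_ofReal_sqrt (hm n)]
    refine ENNReal.ofReal_le_ofReal (Real.sqrt_le_iff.2 ⟨by positivity, ?_⟩)
    simp only [norm_smul, mul_pow, Real.norm_eq_abs, sq_abs]
    rw [Real.sq_sqrt (by positivity)]
    exact integral_boundedExpWeight_sq_le hV0 hω (by positivity) hR hu

end AgmonEstimate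

/-! ### The weighted spectral projection and the conclusion. -/

theorem conj_expWeight {d : ℕ} (ω : ℝ) (x : Space d) :
    starRingEnd ℂ (expWeight ω x) = expWeight ω x :=
  Complex.conj_ofReal _

theorem eLpNorm_coeFn_eq_ofReal_norm {d : ℕ} (u : L2 d) :
    eLpNorm u 2 volume = ENNReal.ofReal ‖u‖ := by
  rw [← Lp.enorm_def, ofReal_norm]

/-- If all `e^{ω⟨x⟩} χⱼ` have norm at most `M` in `L²`, then `e^{ω⟨x⟩} P e^{ω⟨x⟩}` is bounded by
`m M²`. -/
theorem weighted_spectralProjection_bound {d m : ℕ} {ω M : ℝ} (hM : 0 ≤ M) {χ : Fin m → L2 d}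
    (hL : ∀ j, MemLp (fun x => expWeight ω x * χ j x) 2 volume)
    (hχ : ∀ j, eLpNorm (fun x => expWeight ω x * χ j x) 2 volume ≤ ENNReal.ofReal M) (f : L2 d) :
    (∀ j, Integrable (fun y => (expWeight ω y * f y) * starRingEnd ℂ (χ j y)) volume) ∧
      MemLp (fun x => expWeight ω x *
        spectralProjection χ (fun y => expWeight ω y * f y) x) 2 volume ∧
      eLpNorm (fun x => expWeight ω x *
        spectralProjection χ (fun y => expWeight ω y * f y) x) 2 volume
        ≤ ENNReal.ofReal (m * M ^ 2 * ‖f‖) := by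
  let e : Fin m → L2 d := fun j => (hL j).toLp
  have he : ∀ j, e j =ᵐ[volume] fun x => expWeight ω x * χ j x := fun j => (hL j).coeFn_toLp
  have heM : ∀ j, ‖e j‖ ≤ M := fun j => by
    rw [Lp.norm_toLp]
    exact ENNReal.toReal_le_of_le_ofReal hM (hχ j)
  -- The weight is real, so it passes from `f` onto `χⱼ`, turning a formal pairing into an `L²`
  -- inner product.
  have hae : ∀ j, (fun y => inner ℂ (e j y) (f y)) =ᵐ[volume]
      fun y => (expWeight ω y * f y) * starRingEnd ℂ (χ j y) := fun j => by
    filter_upwards [he j] with y hy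
    rw [hy, RCLike.inner_apply, map_mul, conj_expWeight]
    ring
  have hc : ∀ j, ∫ y, (expWeight ω y * f y) * starRingEnd ℂ (χ j y) = inner ℂ (e j) f :=
    fun j => by rw [L2.inner_def, integral_congr_ae (hae j)]
  let s : L2 d := ∑ j, (inner ℂ (e j) f : ℂ) • e j
  have hs : (fun x => expWeight ω x *
      spectralProjection χ (fun y => expWeight ω y * f y) x) =ᵐ[volume] s := by
    have h1 : ∀ᵐ x, ∀ j, ((inner ℂ (e j) f : ℂ) • e j : L2 d) x =
        (inner ℂ (e j) f : ℂ) * (expWeight ω x * χ j x) := by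
      rw [ae_all_iff]
      intro j
      filter_upwards [Lp.coeFn_smul (inner ℂ (e j) f : ℂ) (e j), he j] with x hx hx'
      rw [hx, Pi.smul_apply, smul_eq_mul, hx']
    filter_upwards [h1, Lp.coeFn_finsetSum Finset.univ
      (fun j => (inner ℂ (e j) f : ℂ) • e j)] with x hx hsx
    rw [hsx, Finset.sum_apply, spectralProjection, Finset.mul_sum]
    refine Finset.sum_congr rfl fun j _ => ?_
    rw [hx j, hc j]
    ring
  refine ⟨fun j => (L2.integrable_inner (e j) f).congr (hae j), (Lp.memLp s).ae_eq hs.symm, ?_⟩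
  rw [eLpNorm_congr_ae hs, eLpNorm_coeFn_eq_ofReal_norm]
  refine ENNReal.ofReal_le_ofReal ?_
  calc ‖s‖ ≤ ∑ _j : Fin m, M * ‖f‖ * M := norm_sum_le_of_le _ fun j _ => by
        rw [norm_smul]
        gcongr
        · exact (norm_inner_le_norm _ _).trans (by gcongr; exact heM j)
        · exact heM j
    _ = m * M ^ 2 * ‖f‖ := by
        rw [Finset.sum_const, Finset.card_univ, Fintype.card_fin, nsmul_eq_mul]
        ring

theorem propositionA2 (d : ℕ) (V : Space d → ℝ) (hV : IsConfiningPotential V)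
    (lam : ℝ) (m : ℕ)
    (hlam : (schrodinger V).eigenspace (lam : ℂ) ≠ ⊥)
    (hfin : FiniteDimensional ℂ ((schrodinger V).eigenspace (lam : ℂ)))
    (hm : Module.finrank ℂ ((schrodinger V).eigenspace (lam : ℂ)) = m)
    (ω₀ : ℝ) (hω₀ : 0 < ω₀) :
    ∃ M : ℝ, 0 ≤ M ∧
      -- decay of every normalized eigenfunction
      (∀ χ ∈ (schrodinger V).eigenspace (lam : ℂ), ‖χ‖ = 1 →
        MemLp (fun x => expWeight ω₀ x * χ x) 2 volume ∧
        eLpNorm (fun x => expWeight ω₀ x * χ x) 2 volume ≤ ENNReal.ofReal M) ∧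
      -- the weighted spectral projection, for every orthonormal basis of the eigenspace
      (∀ χ : Fin m → L2 d, Orthonormal ℂ χ →
        (∀ j, χ j ∈ (schrodinger V).eigenspace (lam : ℂ)) →
        ∀ f : L2 d,
          (∀ j, Integrable (fun y => (expWeight ω₀ y * f y) * starRingEnd ℂ (χ j y)) volume) ∧
          MemLp (fun x => expWeight ω₀ x *
            spectralProjection χ (fun y => expWeight ω₀ y * f y) x) 2 volume ∧
          eLpNorm (fun x => expWeight ω₀ x *
            spectralProjection χ (fun y => expWeight ω₀ y * f y) x) 2 volume
            ≤ ENNReal.ofReal (m * M ^ 2 * ‖f‖)) := by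
  obtain ⟨R, hR⟩ := hV.exists_radius (ω₀ ^ 2 + |lam| + 1)
  set M := Real.sqrt (ω₀ ^ 2 + |lam| + 1) * Real.exp (ω₀ * Real.sqrt (1 + R ^ 2))
  have hM : 0 ≤ M := by positivity
  have h1 : ∀ χ ∈ (schrodinger V).eigenspace (lam : ℂ), ‖χ‖ = 1 →
      MemLp (fun x => expWeight ω₀ x * χ x) 2 volume ∧
      eLpNorm (fun x => expWeight ω₀ x * χ x) 2 volume ≤ ENNReal.ofReal M := fun χ hχ hn => by
    have h := eLpNorm_expWeight_mul_le hV.nonneg hω₀.le hR hχ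
    rw [hn, mul_one] at h
    exact ⟨⟨(continuous_expWeight ω₀).aestronglyMeasurable.mul (Lp.aestronglyMeasurable χ),
      h.trans_lt ENNReal.ofReal_lt_top⟩, h⟩
  exact ⟨M, hM, h1, fun χ hχ hmem f => weighted_spectralProjection_bound hM
    (fun j => (h1 _ (hmem j) (hχ.1 j)).1) (fun j => (h1 _ (hmem j) (hχ.1 j)).2) f⟩
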